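/- All graphs are finite, simple, undirected and have at least one vertex; $\operatorname{tw}(G)$ and $\operatorname{cw}(G)$ denote the treewidth and the clique-width of $G$. For a graph $G$ and $A \subseteq V(G)$ with complement $\overline{A} = V(G)\setminus A$, the cut $(A,\overline{A})$ is a *split* of $G$ if $|A| \ge 2$, $|\overline{A}| \ge 2$ and all vertices of $A$ that have a neighbour in $\overline{A}$ have the same neighbourhood in $\overline{A}$. Let $\operatorname{sm}(A) = 1$ if $(A,\overline{A})$ is a split of $G$, and otherwise let $\operatorname{sm}(A)$ be the maximum size of a matching in the bipartite graph formed by the edges of $G$ between $A$ and $\overline{A}$. A *branch decomposition* $(T,\delta)$ of $G$ is a tree $T$ of maximum degree at most $3$ with a bijection $\delta$ from the leaves of $T$ to $V(G)$ (the single node of a one-node tree counts as a leaf). Each edge $e$ of $T$ induces the cut of $G$ given by the leaves of the two components of $T-e$. The *sm-width* of $(T,\delta)$ is the maximum of $\operatorname{sm}(A)$ over the cuts $(A,\overline{A})$ induced by edges of $T$ ($0$ if $T$ has no edge), and $\operatorname{smw}(G)$ is the minimum sm-width over all branch decompositions of $G$. **Proposition.** 1. For every graph $G$, $\operatorname{smw}(G)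 \le \operatorname{tw}(G)+1$. 2. Consequently, every class of graphs of bounded treewidth has bounded sm-width. 3. Every class of graphs of bounded sm-width has bounded clique-width. -/

import Mathlib

universe u

namespace SmWidth

/-! ### Treewidth -/

/-- A tree decomposition of `G`: a finite tree whose nodes carry bags of vertices, such that both
ends of every edge lie in a common bag and, for each vertex, the nodes whose bags contain it induce
a connected (in particular nonempty) subgraph of the tree. -/
structure TreeDecomposition {V : Type u} (G : SimpleGraph V) where
  Node : Type
  finite_node : Finite Node
  tree : SimpleGraph Node
  isTree : tree.IsTree
  bag : Node → Finset V
  edge_mem : ∀ u v : V, G.Adj u v → ∃ t, u ∈ bag t ∧ v ∈ bag t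
  connected : ∀ v : V, (tree.induce {t | v ∈ bag t}).Connected

/-- Largest bag size minus one. (On a graph with at least one vertex some bag is nonempty, so an
empty bag, which counts `0` here, does not affect the maximum.) -/
noncomputable def TreeDecomposition.width {V : Type u} {G : SimpleGraph V}
    (D : TreeDecomposition G) : ℕ∞ :=
  ⨆ t : D.Node, (((D.bag t).card - 1 : ℕ) : ℕ∞)

noncomputable def treewidth {V : Type u} (G : SimpleGraph V) : ℕ∞ :=
  ⨅ D : TreeDecomposition G, D.width

/-! ### Branch decompositions over the vertex set and their widths -/

/-- A leaf of a tree: a node of degree at most one (degree zero occurs only in the one-node tree,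
whose single node counts as a leaf). -/
def IsLeaf {N : Type} (T : SimpleGraph N) (t : N) : Prop :=
  (T.neighborSet t).encard ≤ 1

/-- A branch decomposition of a graph with vertex set `V`: a finite tree of maximum degree at most
three together with a bijection from its leaves to `V`. -/
structure BranchDecomposition (V : Type u) where
  Node : Type
  finite_node : Finite Node
  tree : SimpleGraph Node
  isTree : tree.IsTree
  subcubic : ∀ t, (tree.neighborSet t).encard ≤ 3
  leafEquiv : {t : Node // IsLeaf tree t} ≃ V

/-- The vertices mapped from the leaves in the component of `T - ab` that contains `a`. -/
def BranchDecomposition.side {V : Type u} (D : BranchDecomposition V) (a b : D.Node) : Set V :=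
  {v | (D.tree.deleteEdges {s(a, b)}).Reachable a (D.leafEquiv.symm v : D.Node)}

/-- The `f`-width of a branch decomposition: the maximum of `f` over all cuts induced by edges of
the tree (each edge is taken in both orientations, giving `A` and its complement). -/
noncomputable def BranchDecomposition.width {V : Type u} (D : BranchDecomposition V)
    (f : Set V → ℕ∞) : ℕ∞ :=
  ⨆ (a : D.Node) (b : D.Node) (_ : D.tree.Adj a b), f (D.side a b)

/-- The minimum `f`-width over all branch decompositions. -/
noncomputable def cutWidth (V : Type u) (f : Set V → ℕ∞) : ℕ∞ :=
  ⨅ D : BranchDecomposition V, D.width f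

/-! ### The split-matching cut function -/

/-- Maximum number of edges of a matching in the bipartite graph of the edges of `G` between `A`
and its complement. -/
noncomputable def mm {V : Type u} (G : SimpleGraph V) (A : Set V) : ℕ∞ :=
  ⨆ (M : (G.between A Aᶜ).Subgraph) (_ : M.IsMatching), M.edgeSet.encard

/-- `(A, Aᶜ)` is a split of `G`: both sides have at least two vertices, and all vertices of `A` that
have a neighbour in `Aᶜ` have the same neighbourhood in `Aᶜ`. -/
def IsSplit {V : Type u} (G : SimpleGraph V) (A : Set V) : Prop :=
  2 ≤ A.encard ∧ 2 ≤ Aᶜ.encard ∧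
    ∀ u ∈ A, ∀ v ∈ A, (G.neighborSet u ∩ Aᶜ).Nonempty → (G.neighborSet v ∩ Aᶜ).Nonempty →
      G.neighborSet u ∩ Aᶜ = G.neighborSet v ∩ Aᶜ

open Classical in
noncomputable def sm {V : Type u} (G : SimpleGraph V) (A : Set V) : ℕ∞ :=
  if IsSplit G A then 1 else mm G A

/-- The split-matching-width of `G`. -/
noncomputable def smw {V : Type u} (G : SimpleGraph V) : ℕ∞ :=
  cutWidth V (sm G)

/-! ### Clique-width -/

/-- Clique-width expressions with `k` labels: create one vertex with label `i`; disjoint union; add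
all edges between vertices labelled `i` and vertices labelled `j`, for `i ≠ j`; relabel `i` to
`j`. -/
inductive CliqueExpr (k : ℕ) : Type
  | vertex (i : Fin k) : CliqueExpr k
  | union (e₁ e₂ : CliqueExpr k) : CliqueExpr k
  | join (i j : Fin k) (hij : i ≠ j) (e : CliqueExpr k) : CliqueExpr k
  | relabel (i j : Fin k) (e : CliqueExpr k) : CliqueExpr k

namespace CliqueExpr

/-- Vertex set of the labelled graph constructed by an expression. -/
def Verts {k : ℕ} : CliqueExpr k → Type
  | vertex _ => Unit
  | union e₁ e₂ => e₁.Verts ⊕ e₂.Verts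
  | join _ _ _ e => e.Verts
  | relabel _ _ e => e.Verts

/-- Labels of the labelled graph constructed by an expression. -/
def label {k : ℕ} : (e : CliqueExpr k) → e.Verts → Fin k
  | vertex i => fun _ => i
  | union e₁ e₂ => Sum.elim e₁.label e₂.label
  | join _ _ _ e => e.label
  | relabel i j e => fun x => if e.label x = i then j else e.label x

/-- Underlying graph of the labelled graph constructed by an expression. -/
def graph {k : ℕ} : (e : CliqueExpr k) → SimpleGraph e.Verts
  | vertex _ => (⊥ : SimpleGraph Unit)
  | union e₁ e₂ => SimpleGraph.sum e₁.graph e₂.graph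
  | join i j _ e => e.graph ⊔ SimpleGraph.fromRel (fun x y => e.label x = i ∧ e.label y = j)
  | relabel _ _ e => e.graph

end CliqueExpr

/-- The least number of labels of an expression that constructs `G` up to isomorphism. -/
noncomputable def cliqueWidth {V : Type u} (G : SimpleGraph V) : ℕ∞ :=
  ⨅ (k : ℕ) (_ : ∃ e : CliqueExpr k, Nonempty (e.graph ≃g G)), (k : ℕ∞)

/-! ### Boundedness on classes of graphs -/

/-- The parameter `p` is bounded on the class `𝒢` of finite nonempty graphs. -/
def BoundedOn (p : (V : Type u) → SimpleGraph V → ℕ∞) (𝒢 : (V : Type u) → SimpleGraph V → Prop) :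
    Prop :=
  ∃ k : ℕ, ∀ (V : Type u) [Finite V] [Nonempty V] (G : SimpleGraph V), 𝒢 V G → p V G ≤ k

end SmWidth

/-!
The link between the three widths is that `V` can be assembled from its vertices by binary disjoint
unions passing only through sets whose cut is small. Such an assembly amounts to a branch
decomposition: encode each vertex by its path of left and right turns from the root, and take the
tree of prefixes of the code words.

Conversely, place the vertices of `G` at nodes of a tree. For a node `t`, the parts of `V` beyond
the neighbours of `t` and the vertices placed at `t` itself can be merged one at a time, so working
towards a root one only meets sets that are, for some `t`, unions of such pieces. In a tree
decomposition the bag of `t` covers all edges leaving such a set, and a vertex cover bounds every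
matching, which gives `smw G ≤ treewidth G + 1`. In a branch decomposition, where degrees are at
most three and only the leaves carry a vertex, such a set is empty, everything, or a side of a tree
edge.

For clique-width, call the neighbourhood of `v ∈ A` outside `A` its trace across the cut of `A`. A
split has at most two traces. If instead all matchings across the cut have at most `k` edges, the
ends of a maximal one form a vertex cover `C` with at most `2 * k` vertices, and a vertex of `A`
outside `C` has its trace contained in `C`; so there are at most `2 * k + 2 ^ (2 * k)` traces.
Vertices of `A` with equal traces can share a label for all later joins. Three disjoint blocks of
labels suffice: one for each of the two parts being united, and a fresh one for the relabelled
union.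
-/

namespace SmWidth

/-! ### Assemblies along a tree -/

section Trees

variable {N : Type*} {T : SimpleGraph N} {a b c d m n : N}

/-- The component of `a` in `T - ab`; for an edge `ab` of a tree this is the part of the tree on the
side of `a`. -/
def branch (T : SimpleGraph N) (a b : N) : Set N :=
  {n | (T.deleteEdges {s(a, b)}).Reachable a n}

theorem self_mem_branch : a ∈ branch T a b := SimpleGraph.Reachable.refl a

theorem notMem_branch (hT : T.IsTree) (hab : T.Adj a b) : b ∉ branch T a b :=
  SimpleGraph.isBridge_iff.1 (SimpleGraph.isAcyclic_iff_forall_adj_isBridge.1 hT.isAcyclic hab)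

theorem mem_branch_or_mem_branch (hT : T.IsTree) (a b n : N) :
    n ∈ branch T a b ∨ n ∈ branch T b a := by
  obtain ⟨p⟩ := hT.connected.preconnected n a
  induction p with
  | nil => exact .inl self_mem_branch
  | @cons v w a hvw p ih =>
    by_cases he : s(w, v) = s(a, b)
    · rcases Sym2.eq_iff.1 he with ⟨rfl, rfl⟩ | ⟨rfl, rfl⟩
      · exact .inr self_mem_branch
      · exact .inl self_mem_branch
    · have he' : s(w, v) ≠ s(b, a) := by rwa [Sym2.eq_swap (a := b)]
      exact ih.imp
        (fun hw => hw.trans (SimpleGraph.deleteEdges_adj.2 ⟨hvw.symm, he⟩).reachable)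
        (fun hw => hw.trans (SimpleGraph.deleteEdges_adj.2 ⟨hvw.symm, he'⟩).reachable)

theorem branch_compl (hT : T.IsTree) (hab : T.Adj a b) : (branch T a b)ᶜ = branch T b a := by
  ext n
  refine ⟨(mem_branch_or_mem_branch hT a b n).resolve_left, fun hb ha => ?_⟩
  refine notMem_branch hT hab (SimpleGraph.Reachable.trans ha ?_)
  rw [Sym2.eq_swap]
  exact SimpleGraph.Reachable.symm hb

theorem exists_isPath_cons_of_mem_branch (hT : T.IsTree) (hac : T.Adj a c)
    (hn : n ∈ branch T c a) : ∃ p : T.Walk c n, (SimpleGraph.Walk.cons hac p).IsPath := by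
  classical
  obtain ⟨p, hp⟩ := hn.exists_isPath
  refine ⟨p.mapLe (SimpleGraph.deleteEdges_le _),
    (SimpleGraph.Walk.cons_isPath_iff _ _).2 ⟨hp.mapLe _, fun ha => ?_⟩⟩
  rw [SimpleGraph.Walk.support_mapLe_eq_support] at ha
  exact notMem_branch hT hac.symm ⟨p.takeUntil a ha⟩

theorem eq_of_mem_branch_of_mem_branch (hT : T.IsTree) (hac : T.Adj a c) (had : T.Adj a d)
    (hc : n ∈ branch T c a) (hd : n ∈ branch T d a) : c = d := by
  obtain ⟨p, hp⟩ := exists_isPath_cons_of_mem_branch hT hac hc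
  obtain ⟨q, hq⟩ := exists_isPath_cons_of_mem_branch hT had hd
  have hpq := (hT.isAcyclic.subsingleton_path a n).elim ⟨_, hp⟩ ⟨_, hq⟩
  simpa using congrArg (fun r => r.1.snd) hpq

theorem exists_mem_branch (hT : T.IsTree) (hn : n ≠ a) :
    ∃ c, T.Adj a c ∧ n ∈ branch T c a := by
  obtain ⟨p, hp⟩ := (hT.connected.preconnected a n).exists_isPath
  cases p with
  | nil => exact absurd rfl hn
  | @cons _ c _ hac p =>
    refine ⟨c, hac, ⟨p.toDeleteEdges _ fun e he => ?_⟩⟩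
    rintro rfl
    exact ((SimpleGraph.Walk.cons_isPath_iff _ _).1 hp).2 (p.snd_mem_support_of_mem_edges he)

theorem branch_subset_branch (hT : T.IsTree) (hac : T.Adj a c) (hab : T.Adj a b) (hcb : c ≠ b) :
    branch T c a ⊆ branch T a b := fun n hn => by
  by_contra hnb
  rw [← Set.mem_compl_iff, branch_compl hT hab] at hnb
  exact hcb (eq_of_mem_branch_of_mem_branch hT hac hab hn hnb)

theorem mem_branch_iff_of_connected {s : Set N} (hs : (T.induce s).Connected) (ha : a ∉ s)
    (hm : m ∈ s) (hn : n ∈ s) : m ∈ branch T c a ↔ n ∈ branch T c a := by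
  let f : T.induce s →g T.deleteEdges {s(c, a)} :=
    { toFun := Subtype.val
      map_rel' := fun {x y} hxy => by
        refine SimpleGraph.deleteEdges_adj.2 ⟨hxy, fun he => ha ?_⟩
        rcases Sym2.eq_iff.1 (Set.mem_singleton_iff.1 he) with ⟨-, rfl⟩ | ⟨rfl, -⟩
        exacts [y.2, x.2] }
  have hmn := (hs.preconnected ⟨m, hm⟩ ⟨n, hn⟩).map f
  exact ⟨fun h => h.trans hmn, fun h => h.trans hmn.symm⟩

theorem branch_induction [Finite N] (hT : T.IsTree) {p : N → N → Prop}
    (ih : ∀ a b, T.Adj a b → (∀ c, T.Adj a c → c ≠ b → p c a) → p a b) :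
    ∀ a b, T.Adj a b → p a b := by
  intro a b hab
  induction hs : branch T a b using WellFoundedLT.induction generalizing a b with
  | ind s ihs =>
    subst hs
    refine ih a b hab fun c hac hcb => ihs _ ⟨branch_subset_branch hT hac hab hcb, fun hs => ?_⟩
      _ _ hac.symm rfl
    exact notMem_branch hT hac.symm (hs self_mem_branch)

end Trees

section Built

variable {V : Type*} {P : Set V → Prop} {X : Set V}

/-- `Built P X`: the set `X` can be assembled from singletons by binary disjoint unions in such a
way that every set that occurs satisfies `P`. This is a rooted form of a branch decomposition, in
which the sets that occur are those of the leaves below the nodes. -/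
inductive Built (P : Set V → Prop) : Set V → Prop
  | singleton (v : V) (hv : P {v}) : Built P {v}
  | union {S T : Set V} (hS : Built P S) (hT : Built P T) (hd : Disjoint S T) (hP : P (S ∪ T)) :
      Built P (S ∪ T)

theorem Built.nonempty (h : Built P X) : X.Nonempty := by
  induction h with
  | singleton v _ => exact Set.singleton_nonempty v
  | union _ _ _ _ ih _ => exact ih.inl

theorem Built.finite (h : Built P X) : X.Finite := by
  induction h with
  | singleton v _ => exact Set.finite_singleton v
  | union _ _ _ _ ihS ihT => exact ihS.union ihT

theorem Built.prop (h : Built P X) : P X := by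
  cases h <;> assumption

/-- `X` is a union of sets of the family `B` together with some points outside all of them
(when the sets of `B` are pairwise disjoint). -/
def IsSaturated {ι : Type*} (B : ι → Set V) (X : Set V) : Prop :=
  ∀ i, B i ⊆ X ∨ Disjoint (B i) X

section IsSaturated

variable {ι : Type*} {B : ι → Set V} {Y : Set V}

theorem IsSaturated.compl (hX : IsSaturated B X) : IsSaturated B Xᶜ := fun i =>
  (hX i).symm.imp Disjoint.subset_compl_right fun h => disjoint_compl_right.mono_left h

theorem IsSaturated.diff (hX : IsSaturated B X) (hY : IsSaturated B Y) :
    IsSaturated B (X \ Y) := fun i => by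
  rcases hX i with h | h
  · exact (hY i).symm.imp (fun h' => Set.subset_sdiff.2 ⟨h, h'⟩)
      fun h' => Set.disjoint_sdiff_right.mono_left h'
  · exact .inr (h.mono_right Set.sdiff_subset)

theorem isSaturated_apply (hB : Pairwise (Function.onFun Disjoint B)) (i : ι) :
    IsSaturated B (B i) := fun j => by
  rcases eq_or_ne j i with rfl | hji
  exacts [.inl subset_rfl, .inr (hB hji)]

theorem isSaturated_singleton {v : V} (hv : ∀ i, v ∉ B i) : IsSaturated B {v} := fun i =>
  .inr (Set.disjoint_singleton_right.2 (hv i))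

theorem Built.of_isSaturated [Finite V] (hB : Pairwise (Function.onFun Disjoint B))
    (hP : ∀ Y, Y.Nonempty → IsSaturated B Y → P Y)
    (hbuilt : ∀ i, B i ⊆ X → (B i).Nonempty → Built P (B i)) (hX : IsSaturated B X)
    (hne : X.Nonempty) : Built P X := by
  induction X using WellFoundedLT.induction with
  | ind X ih =>
    obtain ⟨v, hv⟩ := hne
    obtain ⟨K, hvK, hKX, hK, hKbuilt⟩ : ∃ K, v ∈ K ∧ K ⊆ X ∧ IsSaturated B K ∧ Built P K := by
      by_cases h : ∃ i, v ∈ B i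
      · obtain ⟨i, hvi⟩ := h
        have hiX : B i ⊆ X := (hX i).resolve_right (Set.not_disjoint_iff.2 ⟨v, hvi, hv⟩)
        exact ⟨B i, hvi, hiX, isSaturated_apply hB i, hbuilt i hiX ⟨v, hvi⟩⟩
      · have hsat := isSaturated_singleton (not_exists.1 h)
        exact ⟨{v}, rfl, Set.singleton_subset_iff.2 hv, hsat,
          .singleton v (hP _ (Set.singleton_nonempty v) hsat)⟩
    rcases (X \ K).eq_empty_or_nonempty with hempty | hrest
    · rwa [(Set.sdiff_eq_empty.1 hempty).antisymm hKX]
    · have hlt : X \ K < X := ⟨Set.sdiff_subset, fun h => (h hv).2 hvK⟩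
      have hrest_built := ih _ hlt (fun i hi => hbuilt i (hi.trans Set.sdiff_subset))
        (hX.diff hK) hrest
      have hPX := hP X ⟨v, hv⟩ hX
      rw [← Set.union_sdiff_cancel hKX] at hPX ⊢
      exact .union hKbuilt hrest_built Set.disjoint_sdiff_right hPX

end IsSaturated

section Tree

variable {N : Type*} {T : SimpleGraph N} {τ : V → N} {a b t : N} {v : V}

/-- The elements of `V` that a map `τ` to the nodes of a tree `T` places beyond the neighbour `c` of
`t`; empty if `c` is not a neighbour of `t`. -/
def beyond (T : SimpleGraph N) (τ : V → N) (t c : N) : Set V :=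
  {v | T.Adj t c ∧ τ v ∈ branch T c t}

theorem beyond_of_adj {c : N} (h : T.Adj t c) : beyond T τ t c = τ ⁻¹' branch T c t :=
  Set.ext fun _ => and_iff_right h

theorem exists_mem_beyond (hT : T.IsTree) (hv : τ v ≠ t) : ∃ c, v ∈ beyond T τ t c :=
  exists_mem_branch hT hv

theorem pairwise_disjoint_beyond (hT : T.IsTree) (τ : V → N) (t : N) :
    Pairwise (Function.onFun Disjoint (beyond T τ t)) := fun _ _ hcd =>
  Set.disjoint_left.2 fun _ hc hd =>
    hcd (eq_of_mem_branch_of_mem_branch hT hc.1 hd.1 hc.2 hd.2)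

theorem isSaturated_preimage_branch (hT : T.IsTree) (hab : T.Adj a b) :
    IsSaturated (beyond T τ a) (τ ⁻¹' branch T a b) := by
  rw [← compl_compl (τ ⁻¹' branch T a b), ← Set.preimage_compl, branch_compl hT hab,
    ← beyond_of_adj hab]
  exact (isSaturated_apply (pairwise_disjoint_beyond hT τ a) b).compl

theorem built_univ_of_isTree [Finite N] [Finite V] [Nonempty V] (hT : T.IsTree) (τ : V → N)
    (hP : ∀ t X, X.Nonempty → IsSaturated (beyond T τ t) X → P X) : Built P Set.univ := by
  have hbranch : ∀ a b, T.Adj a b → (τ ⁻¹' branch T a b).Nonempty →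
      Built P (τ ⁻¹' branch T a b) := by
    refine branch_induction hT fun a b hab ih => ?_
    refine Built.of_isSaturated (pairwise_disjoint_beyond hT τ a) (hP a) (fun c hc hne => ?_)
      (isSaturated_preimage_branch hT hab)
    have hac : T.Adj a c := hne.some_mem.1
    rw [beyond_of_adj hac] at hc hne ⊢
    refine ih c hac ?_ hne
    rintro rfl
    obtain ⟨v, hv⟩ := hne
    have hv' := hc hv
    rw [Set.mem_preimage, ← branch_compl hT hac] at hv
    exact hv hv'
  obtain ⟨t⟩ := hT.connected.nonempty
  refine Built.of_isSaturated (pairwise_disjoint_beyond hT τ t) (hP t) (fun c _ hne => ?_)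
    (fun c => .inl (Set.subset_univ _)) Set.univ_nonempty
  have htc : T.Adj t c := hne.some_mem.1
  rw [beyond_of_adj htc] at hne ⊢
  exact hbranch _ _ htc.symm hne

end Tree

end Built

/-! ### Branch decompositions from assemblies -/

section PrefixTree

variable {α : Type*} {F : Set (List α)}

/-- The graph on the set `F` of words in which two words are adjacent if one is obtained from the
other by appending a letter. It is a tree when `F` contains the empty word and is closed under
prefixes. -/
def prefixTree (F : Set (List α)) : SimpleGraph F where
  Adj x y := (∃ b, y.1 = x.1 ++ [b]) ∨ ∃ b, x.1 = y.1 ++ [b]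
  symm := ⟨fun _ _ h => h.symm⟩
  loopless := ⟨fun x h => by
    rcases h with ⟨b, h⟩ | ⟨b, h⟩ <;> simpa using congrArg List.length h⟩

theorem reachable_of_isPrefix (hF : ∀ x b, x ++ [b] ∈ F → x ∈ F) {H : SimpleGraph F} {x y : F}
    (hH : ∀ w z : F, x.1 <+: w.1 → (∃ b, z.1 = w.1 ++ [b]) → H.Adj w z) (hxy : x.1 <+: y.1) :
    H.Reachable x y := by
  obtain ⟨y, hy⟩ := y
  obtain ⟨l, rfl⟩ := hxy
  induction l using List.reverseRecOn with
  | nil => exact Eq.subst (motive := H.Reachable x) (Subtype.ext (by simp)) (.refl x)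
  | append_singleton l b ih =>
    have hl : x.1 ++ l ∈ F := hF _ b (by simpa using hy)
    exact (ih hl).trans (hH ⟨_, hl⟩ ⟨_, hy⟩ (List.prefix_append _ _) ⟨b, by simp⟩).reachable

theorem mem_branch_prefixTree (hF : ∀ x b, x ++ [b] ∈ F → x ∈ F) {x y z : F} {b : α}
    (hy : y.1 = x.1 ++ [b]) : z ∈ branch (prefixTree F) y x ↔ y.1 <+: z.1 := by
  have hyx : ¬ y.1 <+: x.1 := fun h => by simpa [hy] using h.length_le
  constructor
  · intro hz
    induction (SimpleGraph.reachable_iff_reflTransGen _ _).1 hz with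
    | refl => exact List.prefix_refl _
    | @tail w z hyw hwz ih =>
      have ih := ih ((SimpleGraph.reachable_iff_reflTransGen _ _).2 hyw)
      obtain ⟨⟨c, hc⟩ | ⟨c, hc⟩, hne⟩ := SimpleGraph.deleteEdges_adj.1 hwz
      · exact hc ▸ ih.trans (List.prefix_append _ _)
      · rw [hc, List.prefix_concat_iff] at ih
        refine ih.resolve_left fun hyz => hne ?_
        obtain rfl : w = y := Subtype.ext (hc.trans hyz.symm)
        obtain rfl : z = x := Subtype.ext (List.append_inj' (hyz.symm.trans hy) rfl).1
        rfl
  · refine reachable_of_isPrefix hF fun u w hu hw => ?_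
    refine SimpleGraph.deleteEdges_adj.2 ⟨.inl hw, fun he => hyx ?_⟩
    rcases Sym2.eq_iff.1 (Set.mem_singleton_iff.1 he) with ⟨-, rfl⟩ | ⟨rfl, -⟩
    · obtain ⟨c, hc⟩ := hw
      exact hu.trans (hc ▸ List.prefix_append _ _)
    · exact hu

theorem isTree_prefixTree (hnil : [] ∈ F) (hF : ∀ x b, x ++ [b] ∈ F → x ∈ F) :
    (prefixTree F).IsTree := by
  have hreach : ∀ x, (prefixTree F).Reachable ⟨[], hnil⟩ x := fun x =>
    reachable_of_isPrefix hF (fun _ _ _ h => .inl h) List.nil_prefix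
  have hbridge : ∀ x y : F, (∃ b, y.1 = x.1 ++ [b]) → (prefixTree F).IsBridge s(y, x) := by
    rintro x y ⟨b, hy⟩
    refine SimpleGraph.isBridge_iff.2 fun hx => ?_
    simpa [hy] using ((mem_branch_prefixTree hF hy).1 hx).length_le
  have : Nonempty F := ⟨⟨[], hnil⟩⟩
  refine ⟨⟨fun x y => (hreach x).symm.trans (hreach y)⟩, ?_⟩
  refine SimpleGraph.isAcyclic_iff_forall_adj_isBridge.2 fun x y h => ?_
  rcases h with h | h
  · exact Sym2.eq_swap ▸ hbridge x y h
  · exact hbridge y x h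

theorem encard_neighborSet_prefixTree_le (x : F) :
    ((prefixTree F).neighborSet x).encard ≤ ENat.card α + 1 := by
  rw [← Subtype.val_injective.encard_image]
  have hsub : Subtype.val '' (prefixTree F).neighborSet x ⊆
      insert x.1.dropLast (Set.range fun b => x.1 ++ [b]) := by
    rintro _ ⟨y, ⟨b, hb⟩ | ⟨b, hb⟩, rfl⟩
    · exact .inr ⟨b, hb.symm⟩
    · exact .inl (by simp [hb])
  refine (Set.encard_le_encard hsub).trans ((Set.encard_insert_le _ _).trans ?_)
  gcongr
  rw [← Set.image_univ, ← Set.encard_univ]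
  exact Set.encard_image_le _ _

end PrefixTree

section BinaryCode

variable {V : Type*} {P : Set V → Prop} {S T : Set V} {g : V → List Bool} {x y : List Bool}

/-- The elements of `S` whose code word under `g` begins with `x`. -/
def cluster (S : Set V) (g : V → List Bool) (x : List Bool) : Set V :=
  {v ∈ S | x <+: g v}

theorem cluster_nil : cluster S g [] = S := by simp [cluster]

theorem cluster_anti (h : x <+: y) : cluster S g y ⊆ cluster S g x := fun _ hv =>
  ⟨hv.1, h.trans hv.2⟩

/-- A prefix-free code on `S` for which the nonempty clusters are the nodes of a full binary tree
and satisfy `P`. -/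
structure IsBinaryCode (P : Set V → Prop) (S : Set V) (g : V → List Bool) : Prop where
  prefixFree : ∀ v ∈ S, ∀ w ∈ S, g v <+: g w → v = w
  sibling : ∀ x b, (cluster S g (x ++ [b])).Nonempty → (cluster S g (x ++ [!b])).Nonempty
  prop : ∀ x, (cluster S g x).Nonempty → P (cluster S g x)

theorem isBinaryCode_singleton {v : V} (hv : P {v}) : IsBinaryCode P {v} fun _ => [] where
  prefixFree := by simp
  sibling x b h := by simp [cluster] at h
  prop x := by
    rintro ⟨w, rfl, hx⟩
    rw [List.prefix_nil.1 hx, cluster_nil]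
    exact hv

theorem cluster_union_cons {g₀ g₁ : V → List Bool} {b c : Bool} (hbc : b ≠ c)
    (hS : ∀ v ∈ S, g v = b :: g₀ v) (hT : ∀ v ∈ T, g v = c :: g₁ v) (x : List Bool) :
    cluster (S ∪ T) g (b :: x) = cluster S g₀ x := by
  ext v
  constructor
  · rintro ⟨hv | hv, h⟩
    · exact ⟨hv, by simpa [hS v hv] using h⟩
    · simp [hT v hv, hbc] at h
  · rintro ⟨hv, h⟩
    exact ⟨.inl hv, by simpa [hS v hv] using h⟩

theorem IsBinaryCode.union {g₀ g₁ : V → List Bool} (hS : IsBinaryCode P S g₀)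
    (hT : IsBinaryCode P T g₁) (hS0 : S.Nonempty) (hT0 : T.Nonempty) (hP : P (S ∪ T))
    (hgS : ∀ v ∈ S, g v = false :: g₀ v) (hgT : ∀ v ∈ T, g v = true :: g₁ v) :
    IsBinaryCode P (S ∪ T) g := by
  have hcS : ∀ x, cluster (S ∪ T) g (false :: x) = cluster S g₀ x :=
    cluster_union_cons Bool.false_ne_true hgS hgT
  have hcT : ∀ x, cluster (S ∪ T) g (true :: x) = cluster T g₁ x :=
    Set.union_comm S T ▸ cluster_union_cons Bool.false_ne_true.symm hgT hgS
  constructor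
  · rintro v (hv | hv) w (hw | hw) h
    · exact hS.prefixFree v hv w hw (by simpa [hgS, hv, hw] using h)
    · simp [hgS v hv, hgT w hw] at h
    · simp [hgT v hv, hgS w hw] at h
    · exact hT.prefixFree v hv w hw (by simpa [hgT, hv, hw] using h)
  · rintro (_ | ⟨_ | _, x⟩) (_ | _) <;>
      simp only [List.nil_append, List.cons_append, hcS, hcT, cluster_nil, Bool.not_true,
        Bool.not_false]
    · exact fun _ => hT0
    · exact fun _ => hS0
    · exact hS.sibling x false
    · exact hS.sibling x true
    · exact hT.sibling x false
    · exact hT.sibling x true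
  · rintro (_ | ⟨_ | _, x⟩)
    · exact fun _ => by rwa [cluster_nil]
    · rw [hcS]; exact hS.prop x
    · rw [hcT]; exact hT.prop x

open Classical in
theorem Built.exists_isBinaryCode (h : Built P S) : ∃ g, IsBinaryCode P S g := by
  induction h with
  | singleton v hv => exact ⟨_, isBinaryCode_singleton hv⟩
  | @union S _ hS hT hd hP ihS ihT =>
    obtain ⟨g₀, hg₀⟩ := ihS
    obtain ⟨g₁, hg₁⟩ := ihT
    exact ⟨S.piecewise (fun v => false :: g₀ v) fun v => true :: g₁ v,
      hg₀.union hg₁ hS.nonempty hT.nonempty hP (fun _ hv => Set.piecewise_eq_of_mem _ _ _ hv)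
        fun _ hv => Set.piecewise_eq_of_notMem _ _ _ (Set.disjoint_right.1 hd hv)⟩

/-- The words that begin some code word. -/
def codePrefixes (g : V → List Bool) : Set (List Bool) :=
  {x | (cluster Set.univ g x).Nonempty}

theorem mem_codePrefixes (g : V → List Bool) (v : V) : g v ∈ codePrefixes g :=
  ⟨v, trivial, List.prefix_refl _⟩

theorem mem_codePrefixes_of_concat (x : List Bool) (b : Bool) (h : x ++ [b] ∈ codePrefixes g) :
    x ∈ codePrefixes g :=
  h.mono (cluster_anti (List.prefix_append _ _))

theorem finite_codePrefixes [Finite V] (g : V → List Bool) : (codePrefixes g).Finite := by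
  refine (Set.finite_iUnion fun v => (g v).inits.finite_toSet).subset ?_
  rintro x ⟨v, -, hx⟩
  exact Set.mem_iUnion.2 ⟨v, (List.mem_inits _ _).2 hx⟩

theorem IsBinaryCode.isLeaf_iff (hg : IsBinaryCode P Set.univ g) {x : codePrefixes g} :
    IsLeaf (prefixTree (codePrefixes g)) x ↔ ∃ v, g v = x := by
  rw [IsLeaf, Set.encard_le_one_iff]
  constructor
  · intro h
    obtain ⟨v, -, l, hl⟩ := x.2
    cases l with
    | nil => exact ⟨v, by simpa using hl.symm⟩
    | cons b l =>
      have hb : x.1 ++ [b] ∈ codePrefixes g := ⟨v, trivial, l, by simpa using hl⟩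
      have heq : x.1 ++ [b] = x.1 ++ [!b] := congrArg Subtype.val
        (h ⟨_, hb⟩ ⟨_, hg.sibling _ _ hb⟩ (.inl ⟨_, rfl⟩) (.inl ⟨_, rfl⟩))
      simp at heq
  · rintro ⟨v, hv⟩
    have hchild : ∀ (y : codePrefixes g) b, y.1 ≠ x.1 ++ [b] := by
      rintro ⟨_, w, -, hw⟩ b rfl
      have hvw : g v <+: g w := hv ▸ (List.prefix_append _ _).trans hw
      rw [← hg.prefixFree v trivial w trivial hvw, hv] at hw
      simpa using hw.length_le
    rintro y z (⟨b, hb⟩ | ⟨b, hb⟩) (⟨c, hc⟩ | ⟨c, hc⟩)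
    · exact absurd hb (hchild y b)
    · exact absurd hb (hchild y b)
    · exact absurd hc (hchild z c)
    · exact Subtype.ext (List.append_inj' (hb.symm.trans hc) rfl).1

theorem IsBinaryCode.bijective_leaf (hg : IsBinaryCode P Set.univ g) :
    Function.Bijective fun v =>
      (⟨⟨g v, mem_codePrefixes g v⟩, hg.isLeaf_iff.2 ⟨v, rfl⟩⟩ :
        {x : codePrefixes g // IsLeaf (prefixTree (codePrefixes g)) x}) := by
  refine ⟨fun v w hvw => ?_, fun x => ?_⟩
  · have hvw : g v = g w := congrArg (·.1.1) hvw
    exact hg.prefixFree v trivial w trivial (hvw ▸ List.prefix_rfl)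
  · exact (hg.isLeaf_iff.1 x.2).imp fun _ h => Subtype.ext (Subtype.ext h)

end BinaryCode

section BranchDecomposition

variable {V : Type u} {P : Set V → Prop}

/-- The leaf of a branch decomposition that is mapped to `v`. -/
def BranchDecomposition.leaf (D : BranchDecomposition V) (v : V) : D.Node :=
  D.leafEquiv.symm v

theorem BranchDecomposition.side_eq_preimage (D : BranchDecomposition V) (a b : D.Node) :
    D.side a b = D.leaf ⁻¹' branch D.tree a b := rfl

theorem BranchDecomposition.compl_side (D : BranchDecomposition V) {a b : D.Node}
    (hab : D.tree.Adj a b) : (D.side a b)ᶜ = D.side b a := by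
  rw [D.side_eq_preimage, D.side_eq_preimage, ← Set.preimage_compl, branch_compl D.isTree hab]

/-- The branch decomposition whose tree consists of the prefixes of the words of a binary code, the
code words being the leaves. -/
noncomputable def IsBinaryCode.branchDecomposition [Finite V] [Nonempty V] {g : V → List Bool}
    (hg : IsBinaryCode P Set.univ g) : BranchDecomposition V where
  Node := codePrefixes g
  finite_node := finite_codePrefixes g
  tree := prefixTree (codePrefixes g)
  isTree := isTree_prefixTree (by simp [codePrefixes, cluster_nil]) mem_codePrefixes_of_concat
  subcubic x := (encard_neighborSet_prefixTree_le x).trans (by norm_num)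
  leafEquiv := (Equiv.ofBijective _ hg.bijective_leaf).symm

theorem IsBinaryCode.side_branchDecomposition [Finite V] [Nonempty V] {g : V → List Bool}
    (hg : IsBinaryCode P Set.univ g) {x y : codePrefixes g} {b : Bool} (hy : y.1 = x.1 ++ [b]) :
    hg.branchDecomposition.side y x = cluster Set.univ g y := by
  ext v
  exact (mem_branch_prefixTree mem_codePrefixes_of_concat hy).trans (and_iff_right trivial).symm

theorem Built.exists_branchDecomposition (h : Built P Set.univ) :
    ∃ D : BranchDecomposition V, ∀ a b, D.tree.Adj a b → P (D.side a b) ∨ P (D.side a b)ᶜ := by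
  have : Finite V := Set.finite_univ_iff.1 h.finite
  have : Nonempty V := h.nonempty.to_type
  obtain ⟨g, hg⟩ := h.exists_isBinaryCode
  have hside : ∀ x y : codePrefixes g, (∃ b, y.1 = x.1 ++ [b]) →
      P (hg.branchDecomposition.side y x) := by
    rintro x y ⟨b, hy⟩
    rw [hg.side_branchDecomposition hy]
    exact hg.prop y y.2
  refine ⟨hg.branchDecomposition, fun x y hxy => ?_⟩
  rw [BranchDecomposition.compl_side _ hxy]
  exact hxy.symm.imp (hside y x) (hside x y)

end BranchDecomposition

/-! ### Treewidth bounds sm-width -/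

section CutCover

variable {V : Type u} {G H : SimpleGraph V} {A C : Set V}

theorem encard_edgeSet_le_of_isVertexCover {M : H.Subgraph} (hM : M.IsMatching)
    (hC : H.IsVertexCover C) : M.edgeSet.encard ≤ C.encard := by
  have hcover : ∀ e : M.edgeSet, ∃ v, v ∈ C ∧ ∃ w, M.Adj v w ∧ e.1 = s(v, w) := by
    rintro ⟨⟨v, w⟩, hvw⟩
    rcases hC (M.adj_sub hvw) with h | h
    · exact ⟨v, h, w, hvw, rfl⟩
    · exact ⟨w, h, v, hvw.symm, Sym2.eq_swap⟩
  choose f hfC w hfw he using hcover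
  refine ENat.card_le_card_of_injective (f := fun e => (⟨f e, hfC e⟩ : C)) fun e e' hee' => ?_
  have hf : f e = f e' := congrArg Subtype.val hee'
  have hw : w e = w e' := hM.eq_of_adj_left (hf ▸ hfw e) (hfw e')
  exact Subtype.ext (by rw [he, he, hf, hw])

theorem mm_le_vertexCoverNum (G : SimpleGraph V) (A : Set V) :
    mm G A ≤ (G.between A Aᶜ).vertexCoverNum := by
  obtain ⟨C, hC, hcover⟩ := (G.between A Aᶜ).vertexCoverNum_exists
  exact hC ▸ iSup₂_le fun M hM => encard_edgeSet_le_of_isVertexCover hM hcover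

theorem sm_le_of_vertexCoverNum_le {k : ℕ∞} (hk : 1 ≤ k)
    (h : (G.between A Aᶜ).vertexCoverNum ≤ k) : sm G A ≤ k := by
  unfold sm
  split_ifs
  exacts [hk, (mm_le_vertexCoverNum G A).trans h]

end CutCover

section Treewidth

variable {V : Type u} {G : SimpleGraph V}

theorem TreeDecomposition.isVertexCover_bag (D : TreeDecomposition G) {τ : V → D.Node}
    (hτ : ∀ v, v ∈ D.bag (τ v)) {t : D.Node} {X : Set V}
    (hX : IsSaturated (beyond D.tree τ t) X) :
    (G.between X Xᶜ).IsVertexCover (D.bag t) := by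
  intro u v huv
  rw [SimpleGraph.between_adj] at huv
  by_contra! hn
  obtain ⟨s, hus, hvs⟩ := D.edge_mem u v huv.1
  obtain ⟨c, htc, hsc⟩ := exists_mem_branch D.isTree (show s ≠ t from fun h => hn.1 (h ▸ hus))
  have huc : u ∈ beyond D.tree τ t c :=
    ⟨htc, (mem_branch_iff_of_connected (D.connected u) hn.1 hus (hτ u)).1 hsc⟩
  have hvc : v ∈ beyond D.tree τ t c :=
    ⟨htc, (mem_branch_iff_of_connected (D.connected v) hn.2 hvs (hτ v)).1 hsc⟩
  rcases hX c with hcX | hcX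
  · exact huv.2.elim (fun h => h.2 (hcX hvc)) fun h => h.1 (hcX huc)
  · rw [Set.disjoint_left] at hcX
    exact huv.2.elim (fun h => hcX huc h.1) fun h => hcX hvc h.2

theorem TreeDecomposition.encard_bag_le (D : TreeDecomposition G) (t : D.Node) :
    (D.bag t : Set V).encard ≤ D.width + 1 := by
  have ht : (((D.bag t).card - 1 : ℕ) : ℕ∞) ≤ D.width :=
    le_iSup (fun t => (((D.bag t).card - 1 : ℕ) : ℕ∞)) t
  calc (D.bag t : Set V).encard = (D.bag t).card := Set.encard_coe_eq_coe_finsetCard _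
    _ ≤ ((D.bag t).card - 1 : ℕ) + 1 := by exact_mod_cast le_tsub_add
    _ ≤ D.width + 1 := by gcongr

theorem TreeDecomposition.built_univ [Finite V] [Nonempty V] (D : TreeDecomposition G) :
    Built (fun X => (G.between X Xᶜ).vertexCoverNum ≤ D.width + 1) Set.univ := by
  have := D.finite_node
  have hτ : ∀ v, ∃ t, v ∈ D.bag t := fun v => nonempty_subtype.1 (D.connected v).nonempty
  choose τ hτ using hτ
  exact built_univ_of_isTree D.isTree τ fun t X _ hX =>
    (D.isVertexCover_bag hτ hX).vertexCoverNum_le.trans (D.encard_bag_le t)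

theorem smw_le_of_built {k : ℕ∞} (hk : 1 ≤ k)
    (h : Built (fun X => (G.between X Xᶜ).vertexCoverNum ≤ k) Set.univ) : smw G ≤ k := by
  obtain ⟨D, hD⟩ := h.exists_branchDecomposition
  refine iInf_le_of_le D (iSup₂_le fun a b => iSup_le fun hab => ?_)
  refine sm_le_of_vertexCoverNum_le hk ((hD a b hab).elim id fun h => ?_)
  rwa [compl_compl, SimpleGraph.between_comm] at h

theorem smw_le_treewidth_add_one [Finite V] [Nonempty V] (G : SimpleGraph V) :
    smw G ≤ treewidth G + 1 := by
  rw [treewidth, ENat.iInf_add]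
  exact le_iInf fun D => smw_le_of_built le_add_self D.built_univ

end Treewidth

/-! ### Branch decompositions as assemblies -/

section EscapingNeighbors

variable {V N : Type*} {T : SimpleGraph N} {τ : V → N} {t : N} {X : Set V}

/-- The neighbours `c` of `t` such that `X` misses an element of `V` that `τ` places beyond `c`. -/
def escapingNeighbors (T : SimpleGraph N) (τ : V → N) (t : N) (X : Set V) : Set N :=
  {c | ¬ beyond T τ t c ⊆ X}

theorem escapingNeighbors_subset_neighborSet : escapingNeighbors T τ t X ⊆ T.neighborSet t :=
  fun _ hc => (Set.not_subset.1 hc).choose_spec.1.1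

theorem IsSaturated.eq_univ_or_eq_preimage_branch (hT : T.IsTree)
    (hX : IsSaturated (beyond T τ t) X) (ht : τ ⁻¹' {t} ⊆ X)
    (hesc : (escapingNeighbors T τ t X).encard ≤ 1) :
    X = Set.univ ∨ ∃ c, T.Adj t c ∧ X = τ ⁻¹' branch T t c := by
  have hmem : ∀ v, (∀ c, v ∈ beyond T τ t c → beyond T τ t c ⊆ X) → v ∈ X := fun v hv => by
    by_cases hvt : τ v = t
    · exact ht hvt
    · exact (exists_mem_beyond hT hvt).elim fun c hvc => hv c hvc hvc
  by_cases hall : ∀ c, beyond T τ t c ⊆ X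
  · exact .inl (Set.eq_univ_of_forall fun v => hmem v fun c _ => hall c)
  obtain ⟨c, hcX⟩ := not_forall.1 hall
  have htc : T.Adj t c := escapingNeighbors_subset_neighborSet hcX
  refine .inr ⟨c, htc, ?_⟩
  rw [← compl_compl X, ← branch_compl hT htc.symm, Set.preimage_compl, ← beyond_of_adj htc]
  refine congrArg _ (Set.Subset.antisymm (fun v hvX => ?_) ?_)
  · by_contra hvc
    refine hvX (hmem v fun d hvd => ?_)
    by_contra hdX
    exact hvc (Set.encard_le_one_iff.1 hesc c d hcX hdX ▸ hvd)
  · exact ((hX c).resolve_left hcX).subset_compl_right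

theorem IsSaturated.encard_escapingNeighbors_le_one_or (hX : IsSaturated (beyond T τ t) X)
    (ht : (T.neighborSet t).encard ≤ 3) :
    (escapingNeighbors T τ t X).encard ≤ 1 ∨ (escapingNeighbors T τ t Xᶜ).encard ≤ 1 := by
  have hdisj : Disjoint (escapingNeighbors T τ t X) (escapingNeighbors T τ t Xᶜ) :=
    Set.disjoint_left.2 fun c hc hc' => hc' ((hX c).resolve_left hc).subset_compl_right
  have hle : (escapingNeighbors T τ t X).encard + (escapingNeighbors T τ t Xᶜ).encard ≤ 3 :=
    calc _ = (escapingNeighbors T τ t X ∪ escapingNeighbors T τ t Xᶜ).encard :=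
          (Set.encard_union_eq hdisj).symm
      _ ≤ (T.neighborSet t).encard := Set.encard_le_encard
          (Set.union_subset escapingNeighbors_subset_neighborSet
            escapingNeighbors_subset_neighborSet)
      _ ≤ 3 := ht
  by_contra! h
  have hge := add_le_add (Order.add_one_le_of_lt h.1) (Order.add_one_le_of_lt h.2)
  exact absurd (hge.trans hle) (by decide)

end EscapingNeighbors

section BranchDecomposition

variable {V : Type u} {P : Set V → Prop} {X : Set V}

theorem BranchDecomposition.encard_escapingNeighbors_le_one_or (D : BranchDecomposition V)
    {t : D.Node} (hX : IsSaturated (beyond D.tree D.leaf t) X) :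
    (D.leaf ⁻¹' {t} ⊆ X ∧ (escapingNeighbors D.tree D.leaf t X).encard ≤ 1) ∨
      (D.leaf ⁻¹' {t} ⊆ Xᶜ ∧ (escapingNeighbors D.tree D.leaf t Xᶜ).encard ≤ 1) := by
  by_cases hleaf : IsLeaf D.tree t
  · have hone : ∀ Y, (escapingNeighbors D.tree D.leaf t Y).encard ≤ 1 := fun Y =>
      (Set.encard_le_encard escapingNeighbors_subset_neighborSet).trans hleaf
    have ht : D.leaf ⁻¹' {t} = {D.leafEquiv ⟨t, hleaf⟩} := by
      ext v
      rw [Set.mem_singleton_iff, ← Equiv.symm_apply_eq, Subtype.ext_iff]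
      rfl
    rw [ht, Set.singleton_subset_iff, Set.singleton_subset_iff]
    exact (em _).imp (⟨·, hone X⟩) (⟨·, hone Xᶜ⟩)
  · have ht : D.leaf ⁻¹' {t} = ∅ := Set.eq_empty_of_forall_notMem fun v hv =>
      hleaf (Set.mem_singleton_iff.1 hv ▸ (D.leafEquiv.symm v).2)
    rw [ht]
    exact (hX.encard_escapingNeighbors_le_one_or (D.subcubic t)).imp
      (⟨Set.empty_subset _, ·⟩) (⟨Set.empty_subset _, ·⟩)

theorem BranchDecomposition.eq_side_of_isSaturated (D : BranchDecomposition V) {t : D.Node}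
    (hX : IsSaturated (beyond D.tree D.leaf t) X) :
    X = ∅ ∨ X = Set.univ ∨ ∃ a b, D.tree.Adj a b ∧ X = D.side a b := by
  rcases D.encard_escapingNeighbors_le_one_or hX with ⟨ht, hesc⟩ | ⟨ht, hesc⟩
  · rcases hX.eq_univ_or_eq_preimage_branch D.isTree ht hesc with h | ⟨c, htc, h⟩
    exacts [.inr (.inl h), .inr (.inr ⟨t, c, htc, h⟩)]
  · rcases hX.compl.eq_univ_or_eq_preimage_branch D.isTree ht hesc with h | ⟨c, htc, h⟩
    · exact .inl (Set.compl_univ_iff.1 h)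
    · refine .inr (.inr ⟨c, t, htc.symm, ?_⟩)
      rw [← D.compl_side htc, D.side_eq_preimage, ← h, compl_compl]

theorem BranchDecomposition.built_univ [Nonempty V] (D : BranchDecomposition V)
    (hside : ∀ a b, D.tree.Adj a b → P (D.side a b)) (huniv : P Set.univ) :
    Built P Set.univ := by
  have := D.finite_node
  have : Finite V := .of_equiv _ D.leafEquiv
  refine built_univ_of_isTree D.isTree D.leaf fun t X hne hX => ?_
  rcases D.eq_side_of_isSaturated hX with rfl | rfl | ⟨a, b, hab, rfl⟩
  exacts [absurd hne Set.not_nonempty_empty, huniv, hside a b hab]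

end BranchDecomposition

/-! ### Traces across a cut -/

section Traces

variable {V : Type*} {G H : SimpleGraph V} {A C : Set V}

theorem encard_verts_le_of_isMatching {M : H.Subgraph} (hM : M.IsMatching) :
    M.verts.encard ≤ 2 * M.edgeSet.encard := by
  obtain hfin | hinf := M.edgeSet.finite_or_infinite
  · have hedge (e : Sym2 V) : (e : Set V).encard ≤ 2 := by
      induction e with
      | h u v =>
        rw [Sym2.coe_mk]
        exact (Set.encard_insert_le _ _).trans (by simp [one_add_one_eq_two])
    calc M.verts.encard = (⋃ e ∈ hfin.toFinset, (e : Set V)).encard := by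
          simp [hM.verts_eq_biUnion_edgeSet]
      _ ≤ ∑ e ∈ hfin.toFinset, (e : Set V).encard := Finset.set_encard_biUnion_le _ _
      _ ≤ hfin.toFinset.card • 2 := Finset.sum_le_card_nsmul _ _ _ fun e _ => hedge e
      _ = 2 * M.edgeSet.encard := by
          rw [hfin.encard_eq_coe_toFinset_card, nsmul_eq_mul, mul_comm]
  · simp [hinf.encard_eq]

theorem exists_isMatching_isVertexCover_verts [Finite V] (H : SimpleGraph V) :
    ∃ M : H.Subgraph, M.IsMatching ∧ H.IsVertexCover M.verts := by
  obtain ⟨M, hM, hmax⟩ := Set.Finite.exists_maximal {M : H.Subgraph | M.IsMatching}.toFinite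
    ⟨⊥, fun _ h => h.elim⟩
  refine ⟨M, hM, fun u v huv => ?_⟩
  by_contra! hn
  have hdisj : Disjoint M.support (H.subgraphOfAdj huv).support := by
    refine Set.disjoint_of_subset M.support_subset_verts
      (SimpleGraph.Subgraph.support_subset_verts _) (Set.disjoint_left.2 fun x hx hx' => ?_)
    rcases hx' with rfl | rfl
    exacts [hn.1 hx, hn.2 hx]
  have hle := hmax (hM.sup (.subgraphOfAdj huv) hdisj) le_sup_left
  exact hn.1 (hle.1 (.inr (.inl rfl)))

theorem vertexCoverNum_le_two_mul_mm {V : Type u} [Finite V] (G : SimpleGraph V) (A : Set V) :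
    (G.between A Aᶜ).vertexCoverNum ≤ 2 * mm G A := by
  obtain ⟨M, hM, hcover⟩ := exists_isMatching_isVertexCover_verts (G.between A Aᶜ)
  calc (G.between A Aᶜ).vertexCoverNum ≤ M.verts.encard := hcover.vertexCoverNum_le
    _ ≤ 2 * M.edgeSet.encard := encard_verts_le_of_isMatching hM
    _ ≤ 2 * mm G A := by gcongr; exact le_iSup₂_of_le M hM le_rfl

/-- The neighbourhood of `v` outside `A`. -/
def trace (G : SimpleGraph V) (A : Set V) (v : V) : Set V :=
  G.neighborSet v ∩ Aᶜ

/-- The traces across the cut `(A, Aᶜ)` of the vertices of `A`. -/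
def traces (G : SimpleGraph V) (A : Set V) : Set (Set V) :=
  trace G A '' A

theorem encard_traces_le_of_isVertexCover {k : ℕ} (hC : (G.between A Aᶜ).IsVertexCover C)
    (hk : C.encard ≤ k) : (traces G A).encard ≤ (k + 2 ^ k : ℕ) := by
  have hsub : traces G A ⊆ trace G A '' C ∪ 𝒫 C := by
    rintro _ ⟨v, hv, rfl⟩
    refine or_iff_not_imp_left.2 fun hvC w hw => ?_
    exact (hC (SimpleGraph.between_adj.2 ⟨hw.1, .inl ⟨hv, hw.2⟩⟩)).resolve_left
      fun h => hvC ⟨v, h, rfl⟩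
  have hpow : (𝒫 C).encard ≤ (2 ^ k : ℕ) := by
    have hfin : C.Finite := Set.finite_of_encard_le_coe hk
    rw [← hfin.powerset.cast_ncard_eq, Set.ncard_powerset C hfin, ENat.natCast_le_natCast]
    rw [← hfin.cast_ncard_eq, ENat.natCast_le_natCast] at hk
    exact Nat.pow_le_pow_right two_pos hk
  calc (traces G A).encard ≤ (trace G A '' C ∪ 𝒫 C).encard := Set.encard_le_encard hsub
    _ ≤ (trace G A '' C).encard + (𝒫 C).encard := Set.encard_union_le _ _
    _ ≤ k + (2 ^ k : ℕ) := add_le_add ((Set.encard_image_le _ _).trans hk) hpow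
    _ = (k + 2 ^ k : ℕ) := by norm_cast

theorem encard_traces_le_two_of_isSplit {V : Type u} {G : SimpleGraph V} {A : Set V}
    (h : IsSplit G A) : (traces G A).encard ≤ 2 := by
  have hne : (traces G A \ {∅}).encard ≤ 1 := by
    rw [Set.encard_le_one_iff]
    rintro _ _ ⟨⟨u, hu, rfl⟩, hu'⟩ ⟨⟨v, hv, rfl⟩, hv'⟩
    exact h.2.2 u hu v hv (Set.nonempty_iff_ne_empty.2 hu') (Set.nonempty_iff_ne_empty.2 hv')
  calc (traces G A).encard ≤ (traces G A \ {∅}).encard + ({∅} : Set (Set V)).encard :=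
        Set.encard_le_encard_sdiff_add_encard _ _
    _ ≤ 1 + 1 := add_le_add hne (Set.encard_singleton _).le
    _ = 2 := one_add_one_eq_two

theorem encard_traces_le_of_sm_le {V : Type u} [Finite V] {G : SimpleGraph V} {A : Set V} {k : ℕ}
    (h : sm G A ≤ k) : (traces G A).encard ≤ (2 * k + 2 ^ (2 * k) : ℕ) := by
  unfold sm at h
  split_ifs at h with hsplit
  · refine (encard_traces_le_two_of_isSplit hsplit).trans ?_
    have hk : 1 ≤ k := by exact_mod_cast h
    exact_mod_cast (by omega : 2 ≤ 2 * k).trans (Nat.le_add_right _ _)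
  · obtain ⟨C, hC, hcover⟩ := (G.between A Aᶜ).vertexCoverNum_exists
    refine encard_traces_le_of_isVertexCover hcover ?_
    calc C.encard ≤ 2 * mm G A := hC ▸ vertexCoverNum_le_two_mul_mm G A
      _ ≤ 2 * k := by gcongr
      _ = (2 * k : ℕ) := by norm_cast

theorem encard_traces_univ_le_one : (traces G Set.univ).encard ≤ 1 := by
  rw [Set.encard_le_one_iff]
  rintro _ _ ⟨u, -, rfl⟩ ⟨v, -, rfl⟩
  simp [trace]

theorem exists_injOn_traces {m : ℕ} (hA : A.Nonempty) (h : (traces G A).encard ≤ m) :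
    ∃ e : Set V → Fin m, Set.InjOn e (traces G A) := by
  have hne : (traces G A).encard ≠ 0 := Set.encard_ne_zero.2 (hA.image _)
  have hm : m ≠ 0 := by
    rintro rfl
    exact hne (by simpa using h)
  have : Nonempty (Fin m) := Fin.pos_iff_nonempty.1 (Nat.pos_of_ne_zero hm)
  obtain ⟨e, -, he⟩ := (Set.finite_of_encard_le_coe h).exists_injOn_of_encard_le
    (t := (Set.univ : Set (Fin m))) (by simpa using h)
  exact ⟨e, he⟩

theorem trace_eq_trace_of_subset {B : Set V} (hAB : A ⊆ B) {u v : V}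
    (h : trace G A u = trace G A v) : trace G B u = trace G B v := by
  have htrace (w : V) : trace G B w = trace G A w ∩ Bᶜ := by
    rw [trace, trace, Set.inter_assoc, Set.inter_eq_right.2 (Set.compl_subset_compl.2 hAB)]
  rw [htrace, htrace, h]

end Traces


/-! ### Few traces give small clique-width -/

section CliqueWidth

variable {V : Type u} {G H : SimpleGraph V} {A B : Set V} {k m : ℕ} {ℓ ℓ' : V → Fin k}

/-- Some clique-width expression constructs, up to isomorphism, the subgraph of `G` induced by `A`
labelled by `ℓ`. The values of `ℓ` outside `A` are irrelevant. -/
def Constructs (G : SimpleGraph V) (A : Set V) (ℓ : V → Fin k) : Prop :=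
  ∃ (e : CliqueExpr k) (φ : e.graph ↪g G), Set.range φ = A ∧ ∀ x, e.label x = ℓ (φ x)

namespace Constructs

theorem congr (h : Constructs G A ℓ) (hadj : ∀ u ∈ A, ∀ v ∈ A, G.Adj u v ↔ H.Adj u v)
    (hℓ : ∀ v ∈ A, ℓ v = ℓ' v) : Constructs H A ℓ' := by
  obtain ⟨e, φ, rfl, hlab⟩ := h
  exact ⟨e, ⟨φ.toEmbedding, ((hadj _ ⟨_, rfl⟩ _ ⟨_, rfl⟩).symm.trans φ.map_adj_iff)⟩, rfl,
    fun x => (hlab x).trans (hℓ _ ⟨x, rfl⟩)⟩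

theorem congr_label (h : Constructs G A ℓ) (hℓ : ∀ v ∈ A, ℓ v = ℓ' v) : Constructs G A ℓ' :=
  h.congr (fun _ _ _ _ => Iff.rfl) hℓ

theorem singleton (G : SimpleGraph V) (v : V) (ℓ : V → Fin k) : Constructs G {v} ℓ := by
  have : Unique (CliqueExpr.vertex (ℓ v)).Verts := inferInstanceAs (Unique Unit)
  exact ⟨.vertex (ℓ v), ⟨⟨fun _ => v, fun _ _ _ => rfl⟩,
    iff_of_false (G.loopless.irrefl v) id⟩, Set.range_const, fun _ => rfl⟩

theorem union (hA : Constructs G A ℓ) (hB : Constructs G B ℓ) (hd : Disjoint A B)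
    (hadj : ∀ u ∈ A, ∀ v ∈ B, ¬ G.Adj u v) : Constructs G (A ∪ B) ℓ := by
  obtain ⟨e₁, φ₁, rfl, hlab₁⟩ := hA
  obtain ⟨e₂, φ₂, rfl, hlab₂⟩ := hB
  have hne (x y) : φ₁ x ≠ φ₂ y := fun h => Set.disjoint_left.1 hd ⟨x, rfl⟩ ⟨y, h.symm⟩
  have hnadj (x y) : ¬ G.Adj (φ₁ x) (φ₂ y) := hadj _ ⟨x, rfl⟩ _ ⟨y, rfl⟩
  refine ⟨.union e₁ e₂, ⟨⟨Sum.elim φ₁ φ₂, φ₁.injective.sumElim φ₂.injective hne⟩, ?_⟩,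
    Set.Sum.elim_range _ _, ?_⟩
  · rintro (x | x) (y | y)
    · exact φ₁.map_adj_iff
    · exact iff_of_false (hnadj x y) (by simp [CliqueExpr.graph])
    · exact iff_of_false (fun h => hnadj y x h.symm) (by simp [CliqueExpr.graph])
    · exact φ₂.map_adj_iff
  · rintro (x | x)
    exacts [hlab₁ x, hlab₂ x]

theorem join (h : Constructs G A ℓ) {i j : Fin k} (hij : i ≠ j) :
    Constructs (G ⊔ .fromRel fun u v => ℓ u = i ∧ ℓ v = j) A ℓ := by
  obtain ⟨e, φ, rfl, hlab⟩ := h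
  have hadj (x y : e.Verts) : (G ⊔ .fromRel fun u v => ℓ u = i ∧ ℓ v = j).Adj (φ x) (φ y) ↔
      (e.graph ⊔ .fromRel fun x y => e.label x = i ∧ e.label y = j).Adj x y := by
    simp [hlab]
  exact ⟨.join i j hij e, ⟨φ.toEmbedding, hadj _ _⟩, rfl, hlab⟩

theorem joins (h : Constructs G A ℓ) {J : Set (Fin k × Fin k)} (hJ : ∀ p ∈ J, p.1 ≠ p.2) :
    Constructs (G ⊔ .fromRel fun u v => (ℓ u, ℓ v) ∈ J) A ℓ := by
  induction J, J.toFinite using Set.Finite.induction_on with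
  | empty => exact h.congr (by simp) fun _ _ => rfl
  | @insert p J _ _ ih =>
    refine ((ih fun q hq => hJ q (.inr hq)).join (hJ p (.inl rfl))).congr (fun u _ v _ => ?_)
      fun _ _ => rfl
    simp only [SimpleGraph.sup_adj, SimpleGraph.fromRel_adj, Set.mem_insert_iff, Prod.ext_iff]
    tauto

theorem union_sdiff_between (hA : Constructs G A ℓ) (hB : Constructs G B ℓ) (hd : Disjoint A B) :
    Constructs (G \ G.between A B) (A ∪ B) ℓ := by
  refine .union (hA.congr (fun u hu v hv => ?_) fun _ _ => rfl)
    (hB.congr (fun u hu v hv => ?_) fun _ _ => rfl) hd fun u hu v hv => ?_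
  · simp [SimpleGraph.between_adj, Set.disjoint_left.1 hd hu, Set.disjoint_left.1 hd hv]
  · simp [SimpleGraph.between_adj, Set.disjoint_right.1 hd hu, Set.disjoint_right.1 hd hv]
  · simp [SimpleGraph.between_adj, hu, hv]

theorem union_join (hA : Constructs G A ℓ) (hB : Constructs G B ℓ) (hd : Disjoint A B)
    (hℓ : ∀ u ∈ A, ∀ v ∈ B, ℓ u ≠ ℓ v)
    (hadj : ∀ u ∈ A, ∀ v ∈ B, ∀ u' ∈ A, ∀ v' ∈ B, ℓ u = ℓ u' → ℓ v = ℓ v' → G.Adj u v →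
      G.Adj u' v') : Constructs G (A ∪ B) ℓ := by
  have hAB {v : V} (hv : v ∈ A) : v ∉ B := Set.disjoint_left.1 hd hv
  have hBA {v : V} (hv : v ∈ B) : v ∉ A := Set.disjoint_right.1 hd hv
  let J : Set (Fin k × Fin k) := {p | ∃ u ∈ A, ∃ v ∈ B, G.Adj u v ∧ (ℓ u, ℓ v) = p}
  have hJ : ∀ p ∈ J, p.1 ≠ p.2 := by
    rintro _ ⟨u, hu, v, hv, -, rfl⟩
    exact hℓ u hu v hv
  have hmem_iff {u v : V} (hu : u ∈ A) (hv : v ∈ B) : (ℓ u, ℓ v) ∈ J ↔ G.Adj u v := by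
    refine ⟨?_, fun h => ⟨u, hu, v, hv, h, rfl⟩⟩
    rintro ⟨u', hu', v', hv', h, heq⟩
    exact hadj u' hu' v' hv' u hu v hv (Prod.ext_iff.1 heq).1 (Prod.ext_iff.1 heq).2 h
  have hnotMem_left {u v : V} (hv : v ∈ A) : (ℓ u, ℓ v) ∉ J := by
    rintro ⟨_, _, w, hw, -, heq⟩
    exact hℓ v hv w hw (Prod.ext_iff.1 heq).2.symm
  have hnotMem_right {u v : V} (hu : u ∈ B) : (ℓ u, ℓ v) ∉ J := by
    rintro ⟨w, hw, _, _, -, heq⟩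
    exact hℓ w hw u hu (Prod.ext_iff.1 heq).1
  refine ((hA.union_sdiff_between hB hd).joins hJ).congr ?_ fun _ _ => rfl
  rintro u (hu | hu) v (hv | hv)
  · simp [SimpleGraph.between_adj, hAB hu, hAB hv, hnotMem_left hu, hnotMem_left hv]
  · simpa [SimpleGraph.between_adj, hu, hv, hmem_iff hu hv, hnotMem_left hu] using G.ne_of_adj
  · simpa [SimpleGraph.between_adj, hu, hv, hmem_iff hv hu, hnotMem_left hv, G.adj_comm u v] using
      fun h : G.Adj v u => h.ne'
  · simp [SimpleGraph.between_adj, hBA hu, hBA hv, hnotMem_right hu, hnotMem_right hv]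

theorem relabel_single (h : Constructs G A ℓ) (i j : Fin k) :
    Constructs G A fun v => if ℓ v = i then j else ℓ v := by
  obtain ⟨e, φ, hA, hlab⟩ := h
  have hlab' (x : e.Verts) : (if e.label x = i then j else e.label x) =
      if ℓ (φ x) = i then j else ℓ (φ x) := by
    rw [hlab]
  exact ⟨.relabel i j e, φ, hA, hlab'⟩

theorem relabel_comp (h : Constructs G A ℓ) {f : Fin k → Fin k}
    (hf : ∀ u ∈ A, ∀ v ∈ A, f (ℓ u) ≠ ℓ v) : Constructs G A (f ∘ ℓ) := by
  classical
  suffices hpart : ∀ J ⊆ ℓ '' A, Constructs G A fun v => if ℓ v ∈ J then f (ℓ v) else ℓ v from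
    (hpart _ subset_rfl).congr_label fun v hv => if_pos ⟨v, hv, rfl⟩
  intro J
  induction J, J.toFinite using Set.Finite.induction_on with
  | empty => simpa using h
  | @insert i J hi _ ih =>
    intro hJ
    obtain ⟨⟨u, hu, rfl⟩, hJA⟩ := Set.insert_subset_iff.1 hJ
    refine ((ih hJA).relabel_single (ℓ u) (f (ℓ u))).congr_label fun v hv => ?_
    by_cases hvJ : ℓ v ∈ J
    · simp [hvJ, hf v hv u hu]
    · by_cases hvu : ℓ v = ℓ u <;> simp [hvJ, hvu, hi]

theorem relabel (h : Constructs G A ℓ) (hfac : ∀ u ∈ A, ∀ v ∈ A, ℓ u = ℓ v → ℓ' u = ℓ' v)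
    (hfresh : ∀ u ∈ A, ∀ v ∈ A, ℓ' u ≠ ℓ v) : Constructs G A ℓ' := by
  have hfac' : (A.domRestrict ℓ').FactorsThrough (A.domRestrict ℓ) :=
    fun u v => hfac u u.2 v v.2
  obtain ⟨f, hf⟩ : ∃ f : Fin k → Fin k, ∀ v ∈ A, f (ℓ v) = ℓ' v :=
    ⟨_, fun v hv => hfac'.extend_apply id ⟨v, hv⟩⟩
  refine (h.relabel_comp fun u hu v hv => ?_).congr_label hf
  rw [hf u hu]
  exact hfresh u hu v hv

theorem cliqueWidth_le (h : Constructs G Set.univ ℓ) : cliqueWidth G ≤ k := by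
  obtain ⟨e, φ, hφ, -⟩ := h
  exact iInf₂_le k ⟨e, ⟨.ofSurjective φ (Set.range_eq_univ.1 hφ)⟩⟩

end Constructs

/-- The labelling of the vertices of `A` by their traces, numbered by `e`, in which all labels are
taken from the block `b` of three disjoint blocks of `m` labels each. -/
def traceLabel (G : SimpleGraph V) (A : Set V) (e : Set V → Fin m) (b : Fin 3) (v : V) :
    Fin (3 * m) :=
  finProdFinEquiv (b, e (trace G A v))

theorem traceLabel_eq_iff {e₁ e₂ : Set V → Fin m} {b₁ b₂ : Fin 3} {u v : V} :
    traceLabel G A e₁ b₁ u = traceLabel G B e₂ b₂ v ↔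
      b₁ = b₂ ∧ e₁ (trace G A u) = e₂ (trace G B v) := by
  simp [traceLabel]

theorem adj_of_trace_eq {u v u' v' : V} (hd : Disjoint A B) (hv : v ∈ B)
    (hu' : u' ∈ A) (huu' : trace G A u = trace G A u') (hvv' : trace G B v = trace G B v')
    (h : G.Adj u v) : G.Adj u' v' := by
  have hvu' : v ∈ trace G A u' := huu' ▸ ⟨h, Set.disjoint_right.1 hd hv⟩
  have hu'v' : u' ∈ trace G B v' := hvv' ▸ ⟨hvu'.1.symm, Set.disjoint_left.1 hd hu'⟩
  exact hu'v'.1.symm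

theorem Constructs.union_traceLabel {eA eB : Set V → Fin m} {b : Fin 3}
    (heA : Set.InjOn eA (traces G A)) (heB : Set.InjOn eB (traces G B)) (hd : Disjoint A B)
    (hA : Constructs G A (traceLabel G A eA (b + 1)))
    (hB : Constructs G B (traceLabel G B eB (b + 2))) (e : Set V → Fin m) :
    Constructs G (A ∪ B) (traceLabel G (A ∪ B) e b) := by
  classical
  let ℓ : V → Fin (3 * m) := A.piecewise (traceLabel G A eA (b + 1)) (traceLabel G B eB (b + 2))
  have hℓA {v} (hv : v ∈ A) : ℓ v = traceLabel G A eA (b + 1) v := Set.piecewise_eq_of_mem _ _ _ hv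
  have hℓB {v} (hv : v ∈ B) : ℓ v = traceLabel G B eB (b + 2) v :=
    Set.piecewise_eq_of_notMem _ _ _ (Set.disjoint_right.1 hd hv)
  have htrA {u v} (hu : u ∈ A) (hv : v ∈ A) (h : ℓ u = ℓ v) : trace G A u = trace G A v := by
    rw [hℓA hu, hℓA hv, traceLabel_eq_iff] at h
    exact heA ⟨u, hu, rfl⟩ ⟨v, hv, rfl⟩ h.2
  have htrB {u v} (hu : u ∈ B) (hv : v ∈ B) (h : ℓ u = ℓ v) : trace G B u = trace G B v := by
    rw [hℓB hu, hℓB hv, traceLabel_eq_iff] at h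
    exact heB ⟨u, hu, rfl⟩ ⟨v, hv, rfl⟩ h.2
  have hne {u v} (hu : u ∈ A) (hv : v ∈ B) : ℓ u ≠ ℓ v := by
    simp [hℓA hu, hℓB hv, traceLabel_eq_iff]
  have hunion : Constructs G (A ∪ B) ℓ :=
    .union_join (hA.congr_label fun v hv => (hℓA hv).symm)
      (hB.congr_label fun v hv => (hℓB hv).symm) hd (fun u hu v hv => hne hu hv)
      fun u hu v hv u' hu' v' hv' huu' hvv' =>
        adj_of_trace_eq hd hv hu' (htrA hu hu' huu') (htrB hv hv' hvv')
  refine hunion.relabel (fun u hu v hv huv => ?_) fun u _ v hv => ?_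
  · refine congrArg (fun X => finProdFinEquiv (b, e X)) ?_
    rcases hu with hu | hu <;> rcases hv with hv | hv
    · exact trace_eq_trace_of_subset Set.subset_union_left (htrA hu hv huv)
    · exact (hne hu hv huv).elim
    · exact (hne hv hu huv.symm).elim
    · exact trace_eq_trace_of_subset Set.subset_union_right (htrB hu hv huv)
  · rcases hv with hv | hv
    · simp [hℓA hv, traceLabel_eq_iff]
    · simp [hℓB hv, traceLabel_eq_iff]

theorem Built.constructs (h : Built (fun X => (traces G X).encard ≤ m) A) (e : Set V → Fin m)
    (b : Fin 3) : Constructs G A (traceLabel G A e b) := by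
  induction h generalizing e b with
  | singleton v _ => exact .singleton G v _
  | union hS hT hd _ ihS ihT =>
    obtain ⟨eS, heS⟩ := exists_injOn_traces hS.nonempty hS.prop
    obtain ⟨eT, heT⟩ := exists_injOn_traces hT.nonempty hT.prop
    exact .union_traceLabel heS heT hd (ihS eS _) (ihT eT _) e

theorem cliqueWidth_le_of_built (h : Built (fun X => (traces G X).encard ≤ m) Set.univ) :
    cliqueWidth G ≤ (3 * m : ℕ) := by
  obtain ⟨e, -⟩ := exists_injOn_traces h.nonempty h.prop
  exact (h.constructs e 0).cliqueWidth_le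

theorem exists_width_le_of_cutWidth_le {f : Set V → ℕ∞} (h : cutWidth V f ≤ k) :
    ∃ D : BranchDecomposition V, D.width f ≤ k := by
  by_contra! hn
  have hlt : (k : ℕ∞) + 1 ≤ cutWidth V f := le_iInf fun D => Order.add_one_le_of_lt (hn D)
  exact absurd (hlt.trans h) (by exact_mod_cast Nat.not_succ_le_self k)

theorem BranchDecomposition.le_width (D : BranchDecomposition V) (f : Set V → ℕ∞) {a b : D.Node}
    (hab : D.tree.Adj a b) : f (D.side a b) ≤ D.width f :=
  le_iSup_of_le a (le_iSup₂_of_le b hab le_rfl)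

theorem cliqueWidth_le_of_smw_le [Finite V] [Nonempty V] (h : smw G ≤ k) :
    cliqueWidth G ≤ (3 * (2 * k + 2 ^ (2 * k)) : ℕ) := by
  obtain ⟨D, hD⟩ := exists_width_le_of_cutWidth_le h
  refine cliqueWidth_le_of_built (D.built_univ (fun a b hab => ?_) ?_)
  · exact encard_traces_le_of_sm_le ((D.le_width _ hab).trans hD)
  · exact encard_traces_univ_le_one.trans
      (by exact_mod_cast Nat.one_le_two_pow.trans (Nat.le_add_left _ _))

end CliqueWidth

end SmWidth

theorem mainTheorem10 :
    (∀ (V : Type u) [Finite V] [Nonempty V] (G : SimpleGraph V),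
      SmWidth.smw G ≤ SmWidth.treewidth G + 1) ∧
    (∀ 𝒢 : (V : Type u) → SimpleGraph V → Prop,
      SmWidth.BoundedOn (fun _ G => SmWidth.treewidth G) 𝒢 →
        SmWidth.BoundedOn (fun _ G => SmWidth.smw G) 𝒢) ∧
    (∀ 𝒢 : (V : Type u) → SimpleGraph V → Prop,
      SmWidth.BoundedOn (fun _ G => SmWidth.smw G) 𝒢 →
        SmWidth.BoundedOn (fun _ G => SmWidth.cliqueWidth G) 𝒢) := by
  refine ⟨fun V _ _ G => SmWidth.smw_le_treewidth_add_one G, ?_, ?_⟩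
  · rintro 𝒢 ⟨k, hk⟩
    refine ⟨k + 1, fun V _ _ G hG => (SmWidth.smw_le_treewidth_add_one G).trans ?_⟩
    push_cast
    gcongr
    exact hk V G hG
  · rintro 𝒢 ⟨k, hk⟩
    exact ⟨_, fun V _ _ G hG => SmWidth.cliqueWidth_le_of_smw_le (hk V G hG)⟩
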